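/- **Setting.** Let $\tau,b,t,m$ be integers with $0<b<\tau$, $t\ge 4\tau$, $m\ge 1$, let $\mathbb F$ be a finite field, and for an integer $n$ write $[n]=\{0,\dots,n\}$. Let $k_0,\dots,k_t\in\{0,\dots,m\}$ be message sizes with $k_i=0$ for $i<2\tau$ and for $i>t-2\tau$; the message packet of time slot $i$ is $S[i]=(S_0[i],\dots,S_{k_i-1}[i])\in\mathbb F^{k_i}$. A *streaming code* has policies $0\le f_i\le k_i$ and parity sizes $p_i\ge 0$, with $p_i=0$ for $i<2\tau$. Its channel packet $X[i]$ consists of the first $f_i$ symbols of $S[i]$, the final $k_{i-1}-f_{i-1}$ symbols of $S[i-1]$ (none if $i=0$), and $p_i$ parity symbols, which are arbitrary functions of $S[0],\dots,S[i-1]$ and the first $f_i$ symbols of $S[i]$. Each $S[i]$ must be decodable from $X[0],\dots,X[\min(i+1,t)]$. It must also be decodable from the packets received among $X[0],\dots,X[\min(i+\tau,t)]$ under every admissible loss pattern; a pattern is admissible if, whenever the packet of a slot $i\le t-\tau-b+1$ is lost, those of the slots $i+b,\dots,i+b+\tau-1$ are received. The *rate* is $\sum_{i=0}^t k_i/\sum_{i=0}^t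 n_i$, where $n_i$ is the length of $X[i]$ (and the rate is $0$ if all $n_i$ are $0$). **Spread Code.** For policies $f=\langle f_i\mid i\in[t]\rangle$ with $0\le f_i\le k_i$, define recursively $f_i'=\max(f_i,p_{i+\tau})$, with $p_i=0$ unless $3\tau\le i\le t-\tau$ (and also for $i>t$), and for $2\tau\le i\le t-2\tau$ $$p_{i+\tau}=\max_{i-b+1\le j\le i+1}\max\Big(0,\ \mathbb 1[j+b-1\ge i+1](k_i-f_i)+\mathbb 1[j\le i]f_i+\sum_{r=j}^{i}(k_{r-1}-f_{r-1}')+\sum_{r=j}^{i-1}f_r'-\sum_{r=j+b}^{i+\tau-1}p_r\Big).$$ Fix a $2m\tau\times 2m\tau$ Cauchy matrix $A$ over $\mathbb F$ (entries $1/(x_i-y_j)$ with all $x_i,y_j$ distinct). The $(\tau,b,t,f)$-Spread Code has policies $f_i'$, parity sizes $p_i$, and parity symbols $P[i]=U[i-\tau]+W[i]A_{(i)}$ (when $p_i>0$). Here $U[i]$ consists of the first $p_{i+\tau}$ symbols of $S[i]$; $V[i]$ consists of the symbols of $S[i]$ in positions $p_{i+\tau},\dots,f_i'-1$ followed by those of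 $S[i-1]$ in positions $f'_{i-1},\dots,k_{i-1}-1$; $W[i]\in\mathbb F^{2m\tau}$ has, for $j=i-\tau,\dots,i-1$, the vector $V[j]$ padded with zeros to length $2m$ in positions $2m(j\bmod\tau),\dots,2m(j\bmod\tau)+2m-1$; and $A_{(i)}$ consists of the columns $2m(i\bmod\tau),\dots,2m(i\bmod\tau)+p_i-1$ of $A$. **Algorithm 2.** Given $l\in[t-\tau]$ and prior values $\bar f_j,\bar p_j$ for $j\in[l]$, it outputs the policies $f=\langle f_i\mid i\in[t]\rangle$ of an optimal solution $(f_i,q_i)_{i\in[t]}$ of the integer program: minimize $\sum_{i=0}^t q_i$ over integers $0\le f_i\le k_i$, $q_i\ge 0$, subject to $f_j=\bar f_j$, $q_j=\bar p_j$ for $j\in[l]$ and, for all $i\in\{3\tau,\dots,t-\tau\}$ and $j\in\{i-\tau-b+1,\dots,i-\tau+1\}$, $$-f_{j-1}-\mathbb 1[j+b-1=i-\tau](k_{i-\tau}-f_{i-\tau})+\sum_{r=j-1}^{i-\tau}k_r\le\sum_{r=j+b}^{i}q_r .$$ **Corollary.** Suppose that, for every $j\in[l]$, the packet $X[j]$ was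 sent with policy $\bar f_j$ (the number of symbols of $S[j]$ in $X[j]$) and $\bar p_j$ parity symbols, and that Algorithm 2 outputs $f$. Then: 1. The $(\tau,b,t,f)$-Spread Code is a streaming code, i.e. it satisfies all the requirements above, including both delay constraints. 2. Its rate is at least that of every streaming code whose packets $X[0],\dots,X[l]$ have policies $\bar f_j$ and parity sizes $\bar p_j$. 3. If the prior transmission $X[0],\dots,X[l]$ was produced by a Spread Code, that is, by the $(\tau,b,t,g)$-Spread Code for some policies $g$ with $g_j=g'_j=\bar f_j$ for $j\in[l]$ and with parity sizes $\bar p_j$ in the slots $j\in[l]$, then the $(\tau,b,t,f)$-Spread Code sends the same packets $X[0],\dots,X[l]$, and its rate is the maximum of the rates of all streaming codes with policies $\bar f_j$ and parity sizes $\bar p_j$ in the slots $j\in[l]$. -/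

import Mathlib

/-! Message packets and streaming codes.

A transmission takes place in the time slots `0, …, t`; the message packet of slot `i` is a vector of
`k i` symbols of the field `F`.  Size sequences are indexed by `ℕ`, and only slots `i ≤ t` matter
(`k` is zero near and beyond the end of the transmission). -/

/-- The messages `S[0], S[1], …` with `S[i] ∈ F ^ (k i)`. -/
abbrev Messages (F : Type*) (k : ℕ → ℕ) : Type _ := (i : ℕ) → Fin (k i) → F

/-- The symbol `S_r[i]`, read as `0` for `r ≥ k i`. -/
def Messages.sym {F : Type*} [Zero F] {k : ℕ → ℕ} (S : Messages F k) (i r : ℕ) : F :=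
  if h : r < k i then S i ⟨r, h⟩ else 0

/-- Given the policies `f`, the number `k_{i-1} - f_{i-1}` of symbols of `S[i-1]` left for the packet
of slot `i`; there are none for `i = 0`. -/
def leftover (k f : ℕ → ℕ) : ℕ → ℕ
  | 0 => 0
  | i + 1 => k i - f i

/-- The data of a (systematic, lossless delay one) streaming code for the message sizes `k`:
`policy i` is the number of symbols of `S[i]` sent in `X[i]`, `par i` is the number of parity symbols
in `X[i]`, and `parity i S` are these symbols.  The laws are in `StreamingCode.IsValid`. -/
structure StreamingCode (F : Type*) (k : ℕ → ℕ) where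
  policy : ℕ → ℕ
  par : ℕ → ℕ
  parity : (i : ℕ) → Messages F k → Fin (par i) → F

namespace StreamingCode

variable {F : Type*} {k : ℕ → ℕ}

/-- The channel packet `X[i]`: the first `f_i` symbols of `S[i]`, then the final `k_{i-1} - f_{i-1}`
symbols of `S[i-1]`, then the parity symbols. -/
def packet [Zero F] (C : StreamingCode F k) (i : ℕ) (S : Messages F k) : List F :=
  List.ofFn (fun r : Fin (C.policy i) => S.sym i r) ++
    List.ofFn (fun r : Fin (leftover k C.policy i) => S.sym (i - 1) (C.policy (i - 1) + r)) ++
    List.ofFn (C.parity i S)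

/-- The size `n_i` of the channel packet `X[i]`. -/
def size (C : StreamingCode F k) (i : ℕ) : ℕ :=
  C.policy i + leftover k C.policy i + C.par i

theorem length_packet [Zero F] (C : StreamingCode F k) (i : ℕ) (S : Messages F k) :
    (C.packet i S).length = C.size i := by
  simp [packet, size, add_assoc]

/-- What the receiver holds at the end of slot `T` when the packets of the slots in `L` are lost:
`Y[j] = X[j]` if it is received, and `none` if it is lost (or not yet sent). -/
def received [Zero F] (C : StreamingCode F k) (t : ℕ) (L : Finset ℕ) (T : ℕ) (S : Messages F k) :
    ℕ → Option (List F) :=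
  fun j => if j ≤ T ∧ j ≤ t ∧ j ∉ L then some (C.packet j S) else none

end StreamingCode

/-- The admissible losses of the channel: if the packet of slot `i ≤ t - τ - b + 1` is lost, the packets
of the slots `i + b, …, i + b + τ - 1` are received. -/
def AdmissibleLoss (τ b t : ℕ) (L : Finset ℕ) : Prop :=
  ∀ i ∈ L, i + τ + b ≤ t + 1 → ∀ j, i + b ≤ j → j < i + b + τ → j ∉ L

namespace StreamingCode

variable {F : Type*} {k : ℕ → ℕ}

/-- Without losses, `S[i]` is decoded by time slot `i + 1`. -/
def LosslessDelay [Zero F] (C : StreamingCode F k) (t : ℕ) : Prop :=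
  ∀ i ≤ t, ∃ dec : (ℕ → Option (List F)) → Fin (k i) → F,
    ∀ S : Messages F k, dec (C.received t ∅ (i + 1) S) = S i

/-- Under any admissible losses, `S[i]` is decoded by time slot `i + τ`. -/
def WorstCaseDelay [Zero F] (C : StreamingCode F k) (τ b t : ℕ) : Prop :=
  ∀ i ≤ t, ∃ dec : (ℕ → Option (List F)) → Fin (k i) → F,
    ∀ L : Finset ℕ, AdmissibleLoss τ b t L →
      ∀ S : Messages F k, dec (C.received t L (i + τ) S) = S i

/-- The laws of a streaming code: `f_i ≤ k_i`; the first `2τ` packets are empty; the parity symbols of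
`X[i]` depend only on `S[0], …, S[i-1]` and on the symbols of `S[i]` sent in `X[i]`; and both delay
constraints hold. -/
structure IsValid [Zero F] (C : StreamingCode F k) (τ b t : ℕ) : Prop where
  policy_le : ∀ i ≤ t, C.policy i ≤ k i
  empty : ∀ i < 2 * τ, C.par i = 0
  causal : ∀ i ≤ t, ∀ S S' : Messages F k, (∀ j < i, S j = S' j) →
    (∀ r < C.policy i, S.sym i r = S'.sym i r) → C.parity i S = C.parity i S'
  lossless : C.LosslessDelay t
  worstCase : C.WorstCaseDelay τ b t

/-- The rate `(∑ k_i) / (∑ n_i)` over the slots `0, …, t`. -/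
noncomputable def rate (C : StreamingCode F k) (t : ℕ) : ℝ :=
  (∑ i ∈ Finset.range (t + 1), (k i : ℝ)) / ∑ i ∈ Finset.range (t + 1), (C.size i : ℝ)

/-- The packets `X[0], …, X[l]` of the code use the policies `f j` and have `p j` parity symbols. -/
def Extends (C : StreamingCode F k) (l : ℕ) (f p : ℕ → ℕ) : Prop :=
  ∀ j ≤ l, C.policy j = f j ∧ C.par j = p j

end StreamingCode

/-! The Spread Code of given policies `f`. -/

/-- The number of parity symbols of `X[i + τ]` as a function of the earlier numbers `p`: the maximum of
`0` and, over the bursts starting in slot `j ∈ {i-b+1, …, i+1}`, of the number of symbols still to be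
recovered by slot `i + τ`.  Here `max (f l) (p (l + τ))` is the number of symbols of `S[l]` that
are sent in `X[l]`. -/
def parityStep (τ b : ℕ) (k f p : ℕ → ℕ) (i : ℕ) : ℕ :=
  (Finset.Icc (i + 1 - b) (i + 1)).sup fun j => Int.toNat
    ((if i + 1 ≤ j + b - 1 then (k i : ℤ) - f i else 0) + (if j ≤ i then (f i : ℤ) else 0)
      + ∑ l ∈ Finset.Icc j i, ((k (l - 1) : ℤ) - max (f (l - 1)) (p (l - 1 + τ) : ℕ))
      + ∑ l ∈ Finset.Ico j i, ((max (f l) (p (l + τ)) : ℕ) : ℤ)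
      - ∑ l ∈ Finset.Ico (j + b) (i + τ), (p l : ℤ))

/-- The table of the first `n` numbers of parity symbols (zero from `n` on). -/
def parityTable (τ b t : ℕ) (k f : ℕ → ℕ) : ℕ → ℕ → ℕ
  | 0 => fun _ => 0
  | n + 1 => Function.update (parityTable τ b t k f n) n
      (if 3 * τ ≤ n ∧ n + τ ≤ t then parityStep τ b k f (parityTable τ b t k f n) (n - τ) else 0)

/-- The number `p_n` of parity symbols of `X[n]` in the Spread Code; see `spreadPar_eq`. -/
def spreadPar (τ b t : ℕ) (k f : ℕ → ℕ) (n : ℕ) : ℕ := parityTable τ b t k f (n + 1) n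

/-- The number `f'_i = max (f_i, p_{i+τ})` of symbols of `S[i]` sent in `X[i]` by the Spread Code. -/
def spreadPolicy (τ b t : ℕ) (k f : ℕ → ℕ) (i : ℕ) : ℕ := max (f i) (spreadPar τ b t k f (i + τ))

theorem parityTable_eq (τ b t : ℕ) (k f : ℕ → ℕ) {n l : ℕ} (h : l < n) :
    parityTable τ b t k f n l = spreadPar τ b t k f l := by
  induction n with
  | zero => omega
  | succ n ih =>
    rcases Nat.lt_succ_iff_lt_or_eq.1 h with h' | rfl
    · rw [parityTable, Function.update_of_ne h'.ne, ih h']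
    · rfl

theorem parityStep_congr {τ b : ℕ} {k f p q : ℕ → ℕ} {i : ℕ} (hi : 0 < i)
    (h : ∀ l < i + τ, p l = q l) : parityStep τ b k f p i = parityStep τ b k f q i := by
  unfold parityStep
  refine Finset.sup_congr rfl fun j _ => ?_
  congr 2
  · congr 1
    · congr 1
      refine Finset.sum_congr rfl fun l hl => ?_
      rw [Finset.mem_Icc] at hl
      rw [h _ (by omega)]
    · refine Finset.sum_congr rfl fun l hl => ?_
      rw [Finset.mem_Ico] at hl
      rw [h _ (by omega)]
  · refine Finset.sum_congr rfl fun l hl => ?_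
    rw [Finset.mem_Ico] at hl
    rw [h _ (by omega)]

/-- The recursion that determines the numbers of parity symbols of the Spread Code. -/
theorem spreadPar_eq {τ : ℕ} (hτ : 0 < τ) (b t : ℕ) (k f : ℕ → ℕ) (n : ℕ) :
    spreadPar τ b t k f n =
      if 3 * τ ≤ n ∧ n + τ ≤ t then parityStep τ b k f (spreadPar τ b t k f) (n - τ) else 0 := by
  rw [spreadPar, parityTable, Function.update_self]
  split_ifs with h
  · exact parityStep_congr (by omega) fun l hl => parityTable_eq _ _ _ _ _ (by omega)
  · rfl

/-- A Cauchy matrix: its entries are `1 / (x i - y j)`, where the `x i` and the `y j` are pairwise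
distinct. -/
def Matrix.IsCauchy {F : Type*} [Field F] {N : ℕ} (A : Matrix (Fin N) (Fin N) F) : Prop :=
  ∃ x y : Fin N → F, Function.Injective x ∧ Function.Injective y ∧ (∀ i j, x i ≠ y j) ∧
    ∀ i j, A i j = 1 / (x i - y j)

section SpreadCode

variable {F : Type*} [Field F] {k : ℕ → ℕ}

/-- The length of `V[j]`. -/
def vLen (τ b t : ℕ) (k f : ℕ → ℕ) (j : ℕ) : ℕ :=
  (spreadPolicy τ b t k f j - spreadPar τ b t k f (j + τ)) +
    leftover k (spreadPolicy τ b t k f) j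

/-- The symbols of `V[j]`: those of `S[j]` in the positions `p_{j+τ}, …, f'_j - 1`, followed by those
of `S[j-1]` in the positions `f'_{j-1}, …, k_{j-1} - 1`.  (`U[j]` consists of the symbols of `S[j]`
in the positions `0, …, p_{j+τ} - 1`.) -/
def vSym (τ b t : ℕ) (f : ℕ → ℕ) (S : Messages F k) (j r : ℕ) : F :=
  if r < spreadPolicy τ b t k f j - spreadPar τ b t k f (j + τ) then
    S.sym j (spreadPar τ b t k f (j + τ) + r)
  else
    S.sym (j - 1) (spreadPolicy τ b t k f (j - 1) +
      (r - (spreadPolicy τ b t k f j - spreadPar τ b t k f (j + τ))))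

/-- The vector `W[i]` of length `2mτ`: for `j ∈ {i-τ, …, i-1}`, the positions
`2m (j mod τ), …, 2m (j mod τ) + 2m - 1` hold `V[j]` followed by zeros. -/
def wVec (τ b t m : ℕ) (f : ℕ → ℕ) (S : Messages F k) (i : ℕ) : Fin (2 * m * τ) → F :=
  fun q => ∑ j ∈ Finset.Ico (i - τ) i,
    if (q : ℕ) / (2 * m) = j % τ ∧ (q : ℕ) % (2 * m) < vLen τ b t k f j then
      vSym τ b t f S j ((q : ℕ) % (2 * m))
    else 0

/-- The Spread Code of the policies `f`, built from the matrix `A`: the parity symbols are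
`P[i] = U[i-τ] + W[i] A_(i)`, where `A_(i)` consists of the columns
`2m (i mod τ), …, 2m (i mod τ) + p_i - 1` of `A`. -/
def spreadCode (τ b t m : ℕ) (k f : ℕ → ℕ) (A : Matrix (Fin (2 * m * τ)) (Fin (2 * m * τ)) F) :
    StreamingCode F k where
  policy := spreadPolicy τ b t k f
  par := spreadPar τ b t k f
  parity i S := fun r => S.sym (i - τ) r +
    if h : 2 * m * (i % τ) + r < 2 * m * τ then
      Matrix.vecMul (wVec τ b t m f S i) A ⟨2 * m * (i % τ) + r, h⟩
    else 0

end SpreadCode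

/-! The integer program for the policies after `X[0], …, X[l]` have been sent. -/

/-- The constraints of the integer program in the variables `f` (policies) and `p` (numbers of parity
symbols), which are natural numbers; the values for the slots `0, …, l` are fixed to `f₀` and `p₀`. -/
structure IPFeasible (τ b t : ℕ) (k : ℕ → ℕ) (l : ℕ) (f₀ p₀ f p : ℕ → ℕ) : Prop where
  policy_le : ∀ i ≤ t, f i ≤ k i
  burst : ∀ i, 3 * τ ≤ i → i + τ ≤ t → ∀ j, i - τ + 1 ≤ j + b → j ≤ i - τ + 1 →
    -(f (j - 1) : ℤ) - (if j + b - 1 = i - τ then (k (i - τ) : ℤ) - f (i - τ) else 0)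
      + ∑ r ∈ Finset.Icc (j - 1) (i - τ), (k r : ℤ) ≤ ∑ r ∈ Finset.Icc (j + b) i, (p r : ℤ)
  prior : ∀ j ≤ l, f j = f₀ j ∧ p j = p₀ j

/-- `f` is an output of the algorithm: the policies of an optimal solution of the integer program that
minimizes the total number of parity symbols. -/
def IPOutput (τ b t : ℕ) (k : ℕ → ℕ) (l : ℕ) (f₀ p₀ f : ℕ → ℕ) : Prop :=
  ∃ p : ℕ → ℕ, IPFeasible τ b t k l f₀ p₀ f p ∧
    ∀ f' p' : ℕ → ℕ, IPFeasible τ b t k l f₀ p₀ f' p' →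
      ∑ i ∈ Finset.range (t + 1), p i ≤ ∑ i ∈ Finset.range (t + 1), p' i

/-! Every message symbol is sent exactly once in the clear (`k t = 0`, so nothing is held over past
slot `t`). Hence the rate depends only on the total number of parity symbols, and the integer
program minimizes the right quantity.

Converse (`StreamingCode.IsValid.burst_le`): after a burst, the symbols that no received packet
carries in the clear must be determined by the parity symbols received before the deadline. Counting
messages over the finite field gives exactly the constraints of the program, so every valid code
with the given prior yields a feasible point.

Optimality (`sum_spreadPar_le`): the recursion for the Spread Code adds parity only when some burst
forces it, and it forces no more than the program's constraint for that burst does, because `f' ≥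
f`. So the prefix sums of its parities are at most those of any feasible solution with policies `f`.

Decodability: the parities from the end of a burst up to slot `i + τ` cover all lost symbols.
Removing the parities reserved for the lost `U` leaves at least as many equations as lost entries of
`V` (`sum_vLen_le_sum_spreadPar`). Every square submatrix of a Cauchy matrix is invertible, so these
equations determine `V`, after which each `U[r]` is read off from `P[r + τ]`.

The third claim rests on causality: `p_n` depends on policies up to slot `n - τ` only, so equal
prior policies give equal prior packets. -/

/-! ### Injectivity of Cauchy submatrices -/

theorem Matrix.IsCauchy.eq_zero_of_vecMul_eq_zero {F : Type*} [Field F] {N : ℕ}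
    {A : Matrix (Fin N) (Fin N) F} (hA : A.IsCauchy) {R C : Finset (Fin N)} (hRC : R.card ≤ C.card)
    {w : Fin N → F} (hw : ∀ i ∉ R, w i = 0) (h : ∀ c ∈ C, Matrix.vecMul w A c = 0) : w = 0 := by
  classical
  obtain ⟨x, y, hx, hy, hxy, hA⟩ := hA
  -- `P` is the numerator of `∑ w i / (x i - Y)` over the common denominator `∏ (x i - Y)`. Its
  -- degree is below `#R ≤ #C`, yet it vanishes at every `y c` with `c ∈ C`. Evaluation at `x i`
  -- isolates `w i`.
  set P : Polynomial F := ∑ i ∈ R, Polynomial.C (w i) *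
    ∏ i' ∈ R.erase i, (Polynomial.C (x i') - Polynomial.X) with hP
  have hdeg : P.degree < C.card := by
    rcases R.eq_empty_or_nonempty with rfl | hR
    · simp only [hP, Finset.sum_empty, Polynomial.degree_zero]
      exact WithBot.bot_lt_coe _
    · refine lt_of_le_of_lt (b := ((R.card - 1 : ℕ) : WithBot ℕ)) ?_ ?_
      · refine (Polynomial.degree_sum_le _ _).trans (Finset.sup_le fun i hi => ?_)
        rw [← Polynomial.smul_eq_C_mul]
        refine (Polynomial.degree_smul_le _ _).trans ?_
        refine (Polynomial.degree_prod_le _ _).trans ?_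
        rw [← Finset.card_erase_of_mem hi]
        refine (Finset.sum_le_card_nsmul _ _ 1 fun i' _ => ?_).trans (by simp)
        rw [← neg_sub, Polynomial.degree_neg, Polynomial.degree_X_sub_C]
      · have := hR.card_pos
        exact_mod_cast (by omega : R.card - 1 < C.card)
  have hP0 : P = 0 := by
    refine Polynomial.eq_zero_of_degree_lt_of_eval_index_eq_zero C (v := y) hy.injOn hdeg fun c hc => ?_
    have h1 : ∑ i ∈ R, w i * (1 / (x i - y c)) = 0 := by
      rw [← h c hc, Matrix.vecMul, dotProduct]
      simp only [hA]
      refine Finset.sum_subset (Finset.subset_univ _) fun i _ hi => ?_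
      rw [hw i hi, zero_mul]
    rw [hP, Polynomial.eval_finsetSum]
    have h2 : ∀ i ∈ R, Polynomial.eval (y c) (Polynomial.C (w i) *
        ∏ i' ∈ R.erase i, (Polynomial.C (x i') - Polynomial.X)) =
        (∏ i ∈ R, (x i - y c)) * (w i * (1 / (x i - y c))) := by
      intro i hi
      have h3 : x i - y c ≠ 0 := sub_ne_zero.2 (hxy i c)
      rw [← Finset.mul_prod_erase R _ hi]
      simp only [Polynomial.eval_mul, Polynomial.eval_C, Polynomial.eval_prod,
        Polynomial.eval_sub, Polynomial.eval_X]
      field_simp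
    rw [Finset.sum_congr rfl h2, ← Finset.mul_sum, h1, mul_zero]
  funext i
  by_cases hi : i ∈ R
  · have h1 : Polynomial.eval (x i) P = 0 := by rw [hP0, Polynomial.eval_zero]
    rw [hP, Polynomial.eval_finsetSum, Finset.sum_eq_single i] at h1
    · simp only [Polynomial.eval_mul, Polynomial.eval_C, Polynomial.eval_prod,
        Polynomial.eval_sub, Polynomial.eval_X] at h1
      refine (mul_eq_zero.1 h1).resolve_right (Finset.prod_ne_zero_iff.2 fun i' hi' => ?_)
      exact sub_ne_zero.2 (hx.ne (Finset.ne_of_mem_erase hi'))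
    · intro i' _ hne
      rw [Polynomial.eval_mul, Polynomial.eval_prod,
        Finset.prod_eq_zero (i := i) (Finset.mem_erase.2 ⟨hne.symm, hi⟩) (by simp), mul_zero]
    · exact fun h => absurd hi h
  · exact hw i hi

/-! Arithmetic of the sizes of the Spread Code. -/

theorem sum_Ico_eq_range_sub (g : ℕ → ℤ) {a c : ℕ} (h : a ≤ c) :
    ∑ r ∈ Finset.Ico a c, g r = ∑ r ∈ Finset.range c, g r - ∑ r ∈ Finset.range a, g r :=
  Finset.sum_Ico_eq_sub g h

theorem sum_Icc_eq_range_sub (g : ℕ → ℤ) {a c : ℕ} (h : a ≤ c + 1) :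
    ∑ r ∈ Finset.Icc a c, g r = ∑ r ∈ Finset.range (c + 1), g r - ∑ r ∈ Finset.range a, g r := by
  rw [← Finset.sum_Ico_eq_sub g h]
  rfl

theorem sum_range_eq_of_eq_zero {g : ℕ → ℤ} {a c : ℕ} (h : a ≤ c)
    (hg : ∀ r, a ≤ r → r < c → g r = 0) :
    ∑ r ∈ Finset.range c, g r = ∑ r ∈ Finset.range a, g r := by
  have := Finset.sum_Ico_eq_sub g h
  rw [Finset.sum_eq_zero fun r hr => hg r (Finset.mem_Ico.1 hr).1 (Finset.mem_Ico.1 hr).2] at this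
  linarith

/-- The number of symbols to be recovered telescopes. -/
theorem sum_leftover_add_sum_policy (k g : ℕ → ℤ) {j i : ℕ} (hj : 0 < j) (hji : j ≤ i) :
    ∑ l ∈ Finset.Icc j i, (k (l - 1) - g (l - 1)) + ∑ l ∈ Finset.Ico j i, g l =
      ∑ r ∈ Finset.range i, k r - ∑ r ∈ Finset.range (j - 1), k r - g (j - 1) := by
  induction i, hji using Nat.le_induction with
  | base =>
    obtain ⟨j, rfl⟩ := Nat.exists_eq_add_of_lt hj
    simp [Finset.sum_range_succ]
  | succ i hi ih =>
    rw [← Finset.insert_Icc_right_eq_Icc_add_one (by omega), Finset.sum_insert (by simp),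
      Finset.sum_Ico_succ_top hi, Finset.sum_range_succ]
    have : i + 1 - 1 = i := rfl
    rw [this]
    linarith

section Sizes

variable {τ b t : ℕ} {k f : ℕ → ℕ}

theorem spreadPar_eq_zero (hτ : 0 < τ) {n : ℕ} (h : n < 3 * τ ∨ t < n + τ) :
    spreadPar τ b t k f n = 0 := by
  rw [spreadPar_eq hτ, if_neg (by omega)]

theorem spreadPar_le_spreadPolicy (i : ℕ) :
    spreadPar τ b t k f (i + τ) ≤ spreadPolicy τ b t k f i := le_max_right _ _

/-- The number of symbols in the maximum of `parityStep` for the burst that starts in slot `j`. -/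
theorem parityStep_term (p : ℕ → ℕ) {i j : ℕ} (hj : 0 < j) (hji : j ≤ i) :
    (if i + 1 ≤ j + b - 1 then (k i : ℤ) - f i else 0) + (if j ≤ i then (f i : ℤ) else 0)
      + ∑ l ∈ Finset.Icc j i, ((k (l - 1) : ℤ) - max (f (l - 1)) (p (l - 1 + τ) : ℕ))
      + ∑ l ∈ Finset.Ico j i, ((max (f l) (p (l + τ)) : ℕ) : ℤ)
      - ∑ l ∈ Finset.Ico (j + b) (i + τ), (p l : ℤ) =
    ∑ r ∈ Finset.range (i + 1), (k r : ℤ) - ∑ r ∈ Finset.range (j - 1), (k r : ℤ)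
      - (max (f (j - 1)) (p (j - 1 + τ)) : ℕ)
      - (if i + 1 ≤ j + b - 1 then 0 else (k i : ℤ) - f i)
      - ∑ l ∈ Finset.Ico (j + b) (i + τ), (p l : ℤ) := by
  -- Telescoping gives the demand the shape of the burst constraint in the integer program, with
  -- `f'_{j-1}` in place of `f_{j-1}`.
  have h := sum_leftover_add_sum_policy (fun r => (k r : ℤ))
    (fun r => ((max (f r) (p (r + τ)) : ℕ) : ℤ)) hj hji
  rw [Finset.sum_range_succ, if_pos hji]
  push_cast at h ⊢
  split_ifs <;> linarith

/-- A burst from slot `i + 1` on spares `X[i]`, so only held-over symbols of `S[i]` count. Here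
`f_i` appears and not `f'_i`, which depends on the `p_{i+τ}` being defined. -/
theorem parityStep_term_succ (hb : 0 < b) (p : ℕ → ℕ) (i : ℕ) :
    (if i + 1 ≤ i + 1 + b - 1 then (k i : ℤ) - f i else 0) + (if i + 1 ≤ i then (f i : ℤ) else 0)
      + ∑ l ∈ Finset.Icc (i + 1) i, ((k (l - 1) : ℤ) - max (f (l - 1)) (p (l - 1 + τ) : ℕ))
      + ∑ l ∈ Finset.Ico (i + 1) i, ((max (f l) (p (l + τ)) : ℕ) : ℤ)
      - ∑ l ∈ Finset.Ico (i + 1 + b) (i + τ), (p l : ℤ) =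
    (k i : ℤ) - f i - ∑ l ∈ Finset.Ico (i + 1 + b) (i + τ), (p l : ℤ) := by
  rw [if_pos (by omega), if_neg (by omega)]
  simp

theorem spreadPar_add_eq (hτ : 0 < τ) {i : ℕ} (hi : 2 * τ ≤ i) (hit : i + 2 * τ ≤ t) :
    spreadPar τ b t k f (i + τ) = parityStep τ b k f (spreadPar τ b t k f) i := by
  rw [spreadPar_eq hτ, if_pos (by omega), Nat.add_sub_cancel]

/-- The parity symbols suffice for the burst that starts in slot `j ≤ i`. -/
theorem demand_le_sum_spreadPar (hb : 0 < b) (hτ : b < τ) {i j : ℕ} (hi : 2 * τ ≤ i)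
    (hit : i + 2 * τ ≤ t) (hj : i + 1 ≤ j + b) (hji : j ≤ i) :
    ∑ r ∈ Finset.range (i + 1), (k r : ℤ) - ∑ r ∈ Finset.range (j - 1), (k r : ℤ)
      - (spreadPolicy τ b t k f (j - 1) : ℤ)
      - (if i + 1 ≤ j + b - 1 then 0 else (k i : ℤ) - f i) ≤
    ∑ r ∈ Finset.range (i + τ + 1), (spreadPar τ b t k f r : ℤ)
      - ∑ r ∈ Finset.range (j + b), (spreadPar τ b t k f r : ℤ) := by
  have h := Int.self_le_toNat (∑ r ∈ Finset.range (i + 1), (k r : ℤ)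
      - ∑ r ∈ Finset.range (j - 1), (k r : ℤ) - (spreadPolicy τ b t k f (j - 1) : ℤ)
      - (if i + 1 ≤ j + b - 1 then 0 else (k i : ℤ) - f i)
      - ∑ l ∈ Finset.Ico (j + b) (i + τ), (spreadPar τ b t k f l : ℤ))
  rw [spreadPolicy, ← parityStep_term (spreadPar τ b t k f) (by omega) hji] at h
  have h2 : _ ≤ parityStep τ b k f (spreadPar τ b t k f) i :=
    Finset.le_sup (s := Finset.Icc (i + 1 - b) (i + 1)) (b := j)
      (Finset.mem_Icc.2 ⟨by omega, by omega⟩)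
  rw [← spreadPar_add_eq (by omega) hi hit] at h2
  have h3 := h.trans (Int.ofNat_le.2 h2)
  rw [parityStep_term _ (by omega) hji, sum_Ico_eq_range_sub _ (by omega)] at h3
  rw [Finset.sum_range_succ _ (i + τ), spreadPolicy]
  linarith

/-- The parity symbols suffice for the burst that starts in slot `i + 1`. -/
theorem leftover_le_sum_spreadPar (hb : 0 < b) (hτ : b < τ) {i : ℕ} (hi : 2 * τ ≤ i)
    (hit : i + 2 * τ ≤ t) :
    (k i : ℤ) - f i ≤ ∑ r ∈ Finset.range (i + τ + 1), (spreadPar τ b t k f r : ℤ)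
      - ∑ r ∈ Finset.range (i + 1 + b), (spreadPar τ b t k f r : ℤ) := by
  have h := Int.self_le_toNat
    ((k i : ℤ) - f i - ∑ l ∈ Finset.Ico (i + 1 + b) (i + τ), (spreadPar τ b t k f l : ℤ))
  rw [← parityStep_term_succ hb] at h
  have h2 : _ ≤ parityStep τ b k f (spreadPar τ b t k f) i :=
    Finset.le_sup (s := Finset.Icc (i + 1 - b) (i + 1)) (b := i + 1)
      (Finset.mem_Icc.2 ⟨by omega, by omega⟩)
  rw [← spreadPar_add_eq (by omega) hi hit] at h2
  have h3 := h.trans (Int.ofNat_le.2 h2)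
  rw [parityStep_term_succ hb, sum_Ico_eq_range_sub _ (by omega)] at h3
  rw [Finset.sum_range_succ _ (i + τ)]
  linarith

/-- A positive number of parity symbols is the one forced by some burst. -/
theorem spreadPar_eq_demand (hb : 0 < b) (hτ : b < τ) {i : ℕ} (hi : 2 * τ ≤ i)
    (hit : i + 2 * τ ≤ t) (hpos : 0 < spreadPar τ b t k f (i + τ)) :
    ((k i : ℤ) - f i = ∑ r ∈ Finset.range (i + τ + 1), (spreadPar τ b t k f r : ℤ)
      - ∑ r ∈ Finset.range (i + 1 + b), (spreadPar τ b t k f r : ℤ)) ∨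
    ∃ j, i + 1 ≤ j + b ∧ j ≤ i ∧
      ∑ r ∈ Finset.range (i + 1), (k r : ℤ) - ∑ r ∈ Finset.range (j - 1), (k r : ℤ)
        - (spreadPolicy τ b t k f (j - 1) : ℤ)
        - (if i + 1 ≤ j + b - 1 then 0 else (k i : ℤ) - f i) =
      ∑ r ∈ Finset.range (i + τ + 1), (spreadPar τ b t k f r : ℤ)
        - ∑ r ∈ Finset.range (j + b), (spreadPar τ b t k f r : ℤ) := by
  obtain ⟨j, hj, hjs⟩ := Finset.exists_mem_eq_sup (Finset.Icc (i + 1 - b) (i + 1))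
    ⟨i + 1, Finset.mem_Icc.2 ⟨by omega, le_rfl⟩⟩ (fun j => Int.toNat
    ((if i + 1 ≤ j + b - 1 then (k i : ℤ) - f i else 0) + (if j ≤ i then (f i : ℤ) else 0)
      + ∑ l ∈ Finset.Icc j i, ((k (l - 1) : ℤ) - max (f (l - 1)) (spreadPar τ b t k f (l - 1 + τ) : ℕ))
      + ∑ l ∈ Finset.Ico j i, ((max (f l) (spreadPar τ b t k f (l + τ)) : ℕ) : ℤ)
      - ∑ l ∈ Finset.Ico (j + b) (i + τ), (spreadPar τ b t k f l : ℤ)))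
  have h1 := (spreadPar_add_eq (b := b) (k := k) (f := f) (by omega) hi hit).trans hjs
  rw [Finset.mem_Icc] at hj
  rcases Nat.lt_or_ge i j with hij | hij
  · obtain rfl : j = i + 1 := by omega
    left
    rw [parityStep_term_succ hb, sum_Ico_eq_range_sub _ (by omega)] at h1
    rw [Finset.sum_range_succ _ (i + τ)]
    omega
  · right
    refine ⟨j, by omega, hij, ?_⟩
    rw [parityStep_term _ (by omega) hij, sum_Ico_eq_range_sub _ (by omega), ← spreadPolicy] at h1
    rw [Finset.sum_range_succ _ (i + τ)]
    omega

/-- The parities up to slot `i + τ - 1` already cover each burst's demand up to `S[i-1]`, and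
including `S[i]` raises that demand by at most `k i`. -/
theorem spreadPar_add_le (hb : 0 < b) (hτ : b < τ) (hk_start : ∀ i < 2 * τ, k i = 0)
    (hf : ∀ i ≤ t, f i ≤ k i) (i : ℕ) : spreadPar τ b t k f (i + τ) ≤ k i := by
  by_cases hi : 2 * τ ≤ i ∧ i + 2 * τ ≤ t
  swap
  · rw [spreadPar_eq_zero (by omega) (by omega)]
    exact Nat.zero_le _
  obtain ⟨hi, hit⟩ := hi
  rcases Nat.eq_zero_or_pos (spreadPar τ b t k f (i + τ)) with h0 | hpos
  · omega
  have hfi := hf i (by omega)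
  have hs := Finset.sum_range_succ (fun r => (spreadPar τ b t k f r : ℤ)) (i + τ)
  rcases spreadPar_eq_demand hb hτ hi hit hpos with h | ⟨j, hj, hji, h⟩
  · have : ∑ r ∈ Finset.range (i + 1 + b), (spreadPar τ b t k f r : ℤ) ≤
        ∑ r ∈ Finset.range (i + τ), (spreadPar τ b t k f r : ℤ) :=
      Finset.sum_le_sum_of_subset_of_nonneg (Finset.range_mono (by omega)) fun _ _ _ => by positivity
    omega
  · have hks := Finset.sum_range_succ (fun r => (k r : ℤ)) i
    have hif : (0 : ℤ) ≤ (if i + 1 ≤ j + b - 1 then 0 else (k i : ℤ) - f i) := by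
      split_ifs <;> omega
    obtain ⟨i, rfl⟩ : ∃ i', i = i' + 1 := ⟨i - 1, by omega⟩
    have hkey : ∑ r ∈ Finset.range (i + 1), (k r : ℤ) - ∑ r ∈ Finset.range (j - 1), (k r : ℤ)
        - (spreadPolicy τ b t k f (j - 1) : ℤ) ≤
        ∑ r ∈ Finset.range (i + τ + 1), (spreadPar τ b t k f r : ℤ)
        - ∑ r ∈ Finset.range (j + b), (spreadPar τ b t k f r : ℤ) := by
      rcases Nat.lt_or_ge i (2 * τ) with hlt | hge
      · have h0 := sum_range_eq_of_eq_zero (g := fun r => (k r : ℤ)) (Nat.zero_le (i + 1))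
          fun r _ hr => by simp [hk_start r (by omega)]
        simp only [Finset.range_zero, Finset.sum_empty] at h0
        have h2 : (0 : ℤ) ≤ ∑ r ∈ Finset.range (j - 1), (k r : ℤ) := by positivity
        have h3 : ∑ r ∈ Finset.range (j + b), (spreadPar τ b t k f r : ℤ) ≤
            ∑ r ∈ Finset.range (i + τ + 1), (spreadPar τ b t k f r : ℤ) :=
          Finset.sum_le_sum_of_subset_of_nonneg (Finset.range_mono (by omega))
            fun _ _ _ => by positivity
        omega
      · rcases Nat.lt_or_ge i j with hij | hij
        · obtain rfl : j = i + 1 := by omega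
          have := leftover_le_sum_spreadPar (t := t) (k := k) (f := f) hb hτ hge (by omega : i + 2 * τ ≤ t)
          have h4 := Finset.sum_range_succ (fun r => (k r : ℤ)) i
          have h5 : f i ≤ spreadPolicy τ b t k f i := le_max_left _ _
          rw [Nat.add_sub_cancel]
          omega
        · have := demand_le_sum_spreadPar (t := t) (k := k) (f := f) hb hτ hge (by omega : i + 2 * τ ≤ t)
            (by omega : i + 1 ≤ j + b) hij
          rw [if_pos (by omega)] at this
          linarith
    rw [show i + τ + 1 = i + 1 + τ by ring] at hkey
    omega

theorem spreadPolicy_le (hb : 0 < b) (hτ : b < τ) (hk_start : ∀ i < 2 * τ, k i = 0)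
    (hf : ∀ i ≤ t, f i ≤ k i) {i : ℕ} (hi : i ≤ t) : spreadPolicy τ b t k f i ≤ k i :=
  max_le (hf i hi) (spreadPar_add_le hb hτ hk_start hf i)

theorem vLen_succ_cast (hb : 0 < b) (hτ : b < τ) (hk_start : ∀ i < 2 * τ, k i = 0)
    (hf : ∀ i ≤ t, f i ≤ k i) {i : ℕ} (hi : i ≤ t) :
    (vLen τ b t k f (i + 1) : ℤ) = spreadPolicy τ b t k f (i + 1)
      - spreadPar τ b t k f (i + 1 + τ) + (k i - spreadPolicy τ b t k f i) := by
  have h1 := spreadPar_le_spreadPolicy (τ := τ) (b := b) (t := t) (k := k) (f := f) (i + 1)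
  have h2 := spreadPolicy_le hb hτ hk_start hf hi
  rw [vLen, leftover]
  omega

/-- `V[r]` is the message part of `X[r]` without `U[r]`, which has length `p_{r+τ}`. The message
parts telescope, as leftovers move to the next slot. -/
theorem sum_vLen (hb : 0 < b) (hτ : b < τ) (hk_start : ∀ i < 2 * τ, k i = 0)
    (hf : ∀ i ≤ t, f i ≤ k i) {j e : ℕ} (hj : 0 < j) (hje : j ≤ e) (he : e ≤ t) :
    ∑ r ∈ Finset.range (e + 1), (vLen τ b t k f r : ℤ)
        - ∑ r ∈ Finset.range j, (vLen τ b t k f r : ℤ) =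
      spreadPolicy τ b t k f e - spreadPolicy τ b t k f (j - 1)
      + (∑ r ∈ Finset.range e, (k r : ℤ) - ∑ r ∈ Finset.range (j - 1), (k r : ℤ))
      - (∑ r ∈ Finset.range (e + τ + 1), (spreadPar τ b t k f r : ℤ)
        - ∑ r ∈ Finset.range (j + τ), (spreadPar τ b t k f r : ℤ)) := by
  induction e, hje using Nat.le_induction with
  | base =>
    obtain ⟨j, rfl⟩ : ∃ j', j = j' + 1 := ⟨j - 1, by omega⟩
    have h := vLen_succ_cast hb hτ hk_start hf (by omega : j ≤ t)
    rw [Finset.sum_range_succ _ (j + 1), Finset.sum_range_succ _ (j + 1 + τ), h,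
      Nat.add_sub_cancel, Finset.sum_range_succ (fun r => (k r : ℤ)) j]
    ring
  | succ e hje ih =>
    have h := vLen_succ_cast hb hτ hk_start hf (by omega : e ≤ t)
    have ih := ih (by omega)
    rw [Finset.sum_range_succ _ (e + 1), Finset.sum_range_succ _ (e + 1 + τ), h,
      Finset.sum_range_succ (fun r => (k r : ℤ)) e, show e + 1 + τ = e + τ + 1 by ring]
    linarith

/-- After a burst in the slots `j, …, j + b - 1`, the parity symbols of the slots
`j + b, …, j + τ - 1` are at least as many as the lost symbols of the vectors `V`. -/
theorem sum_vLen_le_sum_spreadPar (hb : 0 < b) (hτ : b < τ) (hk_start : ∀ i < 2 * τ, k i = 0)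
    (hk_end : ∀ i, t < i + 2 * τ → k i = 0)
    (hf : ∀ i ≤ t, f i ≤ k i) {j : ℕ} (hj : 2 * τ ≤ j) (hjt : j + 2 * τ ≤ t + 1) :
    ∑ r ∈ Finset.Ico j (j + b), vLen τ b t k f r ≤
      ∑ r ∈ Finset.Ico (j + b) (j + τ), spreadPar τ b t k f r := by
  zify
  rw [sum_Ico_eq_range_sub _ (by omega), sum_Ico_eq_range_sub _ (by omega)]
  obtain ⟨e, he⟩ : ∃ e, j + b = e + 1 := ⟨j + b - 1, by omega⟩
  have hV := sum_vLen hb hτ hk_start hf (by omega : 0 < j) (by omega : j ≤ e) (by omega)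
  rw [he, hV]
  have hK := Finset.sum_range_succ (fun r => (k r : ℤ)) e
  have hff : f e ≤ spreadPolicy τ b t k f e := le_max_left _ _
  have hfj : f (j - 1) ≤ spreadPolicy τ b t k f (j - 1) := le_max_left _ _
  -- the burst starting in slot `j` for the symbols sent up to slot `j - 1`
  have hbase : (k (j - 1) : ℤ) - spreadPolicy τ b t k f (j - 1) ≤
      ∑ r ∈ Finset.range (j + τ), (spreadPar τ b t k f r : ℤ)
        - ∑ r ∈ Finset.range (j + b), (spreadPar τ b t k f r : ℤ) := by
    rcases Nat.lt_or_ge (j - 1) (2 * τ) with h | h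
    · have h3 : ∑ r ∈ Finset.range (j + b), (spreadPar τ b t k f r : ℤ) ≤
          ∑ r ∈ Finset.range (j + τ), (spreadPar τ b t k f r : ℤ) :=
        Finset.sum_le_sum_of_subset_of_nonneg (Finset.range_mono (by omega))
          fun _ _ _ => by positivity
      rw [hk_start _ h]
      omega
    · have := leftover_le_sum_spreadPar (t := t) (k := k) (f := f) hb hτ h (by omega : j - 1 + 2 * τ ≤ t)
      rw [show j - 1 + τ + 1 = j + τ by omega, show j - 1 + 1 + b = j + b by omega] at this
      omega
  have hKj := Finset.sum_range_succ (fun r => (k r : ℤ)) (j - 1)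
  rw [show j - 1 + 1 = j by omega] at hKj
  rw [he] at hbase
  -- Here `e` is the last slot of the burst. If `e > t - 2τ`, then messages and parities beyond the
  -- last active slots vanish, and the demand is taken at slot `t - 2τ`, or is `hbase` if the burst
  -- starts later.
  rcases Nat.lt_or_ge t (e + 2 * τ) with hlate | hin
  · have hke := hk_end e hlate
    have hpe := spreadPolicy_le hb hτ hk_start hf (by omega : e ≤ t)
    rcases Nat.lt_or_ge t (j + 2 * τ) with hjl | hjl
    · have h1 := sum_range_eq_of_eq_zero (g := fun r => (k r : ℤ)) (by omega : j ≤ e)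
        fun r hr _ => by simp [hk_end r (by omega)]
      have h2 := sum_range_eq_of_eq_zero (g := fun r => (spreadPar τ b t k f r : ℤ))
        (by omega : j + τ ≤ e + τ + 1)
        fun r hr _ => by simp [spreadPar_eq_zero (show 0 < τ by omega) (.inr (by omega : t < r + τ))]
      omega
    · have h1 := sum_range_eq_of_eq_zero (g := fun r => (k r : ℤ)) (by omega : t - 2 * τ + 1 ≤ e)
        fun r hr _ => by simp [hk_end r (by omega)]
      have h2 := sum_range_eq_of_eq_zero (g := fun r => (spreadPar τ b t k f r : ℤ))
        (by omega : t - 2 * τ + τ + 1 ≤ e + τ + 1)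
        fun r hr _ => by simp [spreadPar_eq_zero (show 0 < τ by omega) (.inr (by omega : t < r + τ))]
      have h3 := demand_le_sum_spreadPar (t := t) (k := k) (f := f) hb hτ (by omega : 2 * τ ≤ t - 2 * τ)
        (by omega) (by omega : t - 2 * τ + 1 ≤ j + b) (by omega)
      rw [if_pos (by omega), he] at h3
      omega
  · by_cases hfe : spreadPolicy τ b t k f e = f e
    · have h3 := demand_le_sum_spreadPar (t := t) (k := k) (f := f) hb hτ (by omega : 2 * τ ≤ e)
        (by omega) (by omega : e + 1 ≤ j + b) (by omega)
      rw [if_neg (by omega), he] at h3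
      omega
    -- Now all of `S[e]` sent in `X[e]` lies in `U[e]`, so `V[e]` holds only leftovers of `S[e-1]`
    -- and the demand one slot earlier suffices.
    · have hfp : spreadPolicy τ b t k f e = spreadPar τ b t k f (e + τ) := by
        rcases max_choice (f e) (spreadPar τ b t k f (e + τ)) with h | h
        · exact absurd h hfe
        · exact h
      have hP := Finset.sum_range_succ (fun r => (spreadPar τ b t k f r : ℤ)) (e + τ)
      rcases (by omega : j = e ∨ j < e) with rfl | hlt
      · omega
      · obtain ⟨e, rfl⟩ : ∃ e', e = e' + 1 := ⟨e - 1, by omega⟩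
        have h3 := demand_le_sum_spreadPar (t := t) (k := k) (f := f) hb hτ (by omega : 2 * τ ≤ e)
          (by omega) (by omega : e + 1 ≤ j + b) (by omega)
        rw [if_pos (by omega), he] at h3
        rw [show e + τ + 1 = e + 1 + τ by ring] at h3
        omega

/-- The Spread Code has at most as many parity symbols as any solution of the integer program. -/
theorem sum_spreadPar_le (hb : 0 < b) (hτ : b < τ) {l : ℕ} {f₀ p₀ q : ℕ → ℕ}
    (h : IPFeasible τ b t k l f₀ p₀ f q) (n : ℕ) :
    ∑ r ∈ Finset.range n, (spreadPar τ b t k f r : ℤ) ≤ ∑ r ∈ Finset.range n, (q r : ℤ) := by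
  induction n using Nat.strong_induction_on with
  | _ n ih =>
    rcases n with _ | n
    · simp
    rcases Nat.eq_zero_or_pos (spreadPar τ b t k f n) with h0 | hpos
    · rw [Finset.sum_range_succ, Finset.sum_range_succ, h0]
      have := ih n (by omega)
      omega
    have hn : 3 * τ ≤ n ∧ n + τ ≤ t := by
      by_contra hn
      rw [spreadPar_eq_zero (by omega) (by omega)] at hpos
      omega
    obtain ⟨i, rfl⟩ : ∃ i, n = i + τ := ⟨n - τ, by omega⟩
    have hB := h.burst (i + τ) (by omega) (by omega)
    simp only [Nat.add_sub_cancel] at hB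
    -- For the forcing burst, the sum of the `p` from its end to slot `i + τ` equals its demand,
    -- which the constraint bounds by the same sum of the `q`. The slots before are covered by
    -- induction.
    rcases spreadPar_eq_demand hb hτ (by omega) (by omega) hpos with h1 | ⟨j, hj, hji, h1⟩
    · have h2 := hB (i + 1) (by omega) (by omega)
      have h3 := ih (i + 1 + b) (by omega)
      rw [if_neg (by omega), sum_Icc_eq_range_sub _ (by omega),
        sum_Icc_eq_range_sub _ (by omega)] at h2
      have h4 := Finset.sum_range_succ (fun r => (k r : ℤ)) i
      rw [Nat.add_sub_cancel] at h2
      omega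
    · have h2 := hB j (by omega) (by omega)
      have h3 := ih (j + b) (by omega)
      rw [sum_Icc_eq_range_sub _ (by omega), sum_Icc_eq_range_sub _ (by omega)] at h2
      have h5 : f (j - 1) ≤ spreadPolicy τ b t k f (j - 1) := le_max_left _ _
      split_ifs at h1 h2 <;> omega

/-- The sizes of the Spread Code depend on the earlier policies only. -/
theorem spreadPar_congr (hb : 0 < b) (hτ : b < τ) {g : ℕ → ℕ} {l : ℕ} (h : ∀ j ≤ l, f j = g j)
    {n : ℕ} (hn : n ≤ l + τ) : spreadPar τ b t k f n = spreadPar τ b t k g n := by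
  induction n using Nat.strong_induction_on with
  | _ n ih =>
    rw [spreadPar_eq (by omega), spreadPar_eq (by omega)]
    split_ifs with hc
    · rw [parityStep_congr (by omega) fun r hr => ih r (by omega) (by omega)]
      unfold parityStep
      refine Finset.sup_congr rfl fun j hj => ?_
      rw [Finset.mem_Icc] at hj
      have h1 : ∑ l ∈ Finset.Icc j (n - τ), ((k (l - 1) : ℤ) -
          max (f (l - 1)) (spreadPar τ b t k g (l - 1 + τ) : ℕ)) =
          ∑ l ∈ Finset.Icc j (n - τ), ((k (l - 1) : ℤ) -
          max (g (l - 1)) (spreadPar τ b t k g (l - 1 + τ) : ℕ)) :=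
        Finset.sum_congr rfl fun r hr => by
          rw [Finset.mem_Icc] at hr
          rw [h (r - 1) (by omega)]
      have h2 : ∑ l ∈ Finset.Ico j (n - τ),
          ((max (f l) (spreadPar τ b t k g (l + τ)) : ℕ) : ℤ) = ∑ l ∈ Finset.Ico j (n - τ),
          ((max (g l) (spreadPar τ b t k g (l + τ)) : ℕ) : ℤ) :=
        Finset.sum_congr rfl fun r hr => by
          rw [Finset.mem_Ico] at hr
          rw [h r (by omega)]
      rw [h1, h2, h (n - τ) (by omega)]
    · rfl

theorem spreadPolicy_congr (hb : 0 < b) (hτ : b < τ) {g : ℕ → ℕ} {l : ℕ} (h : ∀ j ≤ l, f j = g j)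
    {j : ℕ} (hj : j ≤ l) : spreadPolicy τ b t k f j = spreadPolicy τ b t k g j := by
  rw [spreadPolicy, spreadPolicy, h j hj, spreadPar_congr hb hτ h (by omega)]

end Sizes

/-! ### Symbols, packets and block positions modulo `τ` -/

theorem Messages.sym_of_le {F : Type*} [Zero F] {k : ℕ → ℕ} (S : Messages F k) {i r : ℕ}
    (h : k i ≤ r) : S.sym i r = 0 := dif_neg (by omega)

theorem Messages.sym_sub {F : Type*} [Field F] {k : ℕ → ℕ} (S S' : Messages F k) (i r : ℕ) :
    Messages.sym (S - S') i r = S.sym i r - S'.sym i r := by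
  unfold Messages.sym
  split_ifs
  · rfl
  · simp

theorem Messages.eq_of_sym_eq {F : Type*} [Zero F] {k : ℕ → ℕ} {S S' : Messages F k} {i : ℕ}
    (h : ∀ r < k i, S.sym i r = S'.sym i r) : S i = S' i := by
  funext r
  have := h r r.2
  simpa [Messages.sym] using this

theorem StreamingCode.packet_eq_iff {F : Type*} [Zero F] {k : ℕ → ℕ} (C : StreamingCode F k) (i : ℕ)
    (S S' : Messages F k) : C.packet i S = C.packet i S' ↔
      (∀ r < C.policy i, S.sym i r = S'.sym i r) ∧
      (∀ r < leftover k C.policy i,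
        S.sym (i - 1) (C.policy (i - 1) + r) = S'.sym (i - 1) (C.policy (i - 1) + r)) ∧
      C.parity i S = C.parity i S' := by
  unfold StreamingCode.packet
  constructor
  · intro h
    obtain ⟨h, h3⟩ := List.append_inj h (by simp)
    obtain ⟨h1, h2⟩ := List.append_inj h (by simp)
    exact ⟨fun r hr => congrFun (List.ofFn_injective h1) ⟨r, hr⟩,
      fun r hr => congrFun (List.ofFn_injective h2) ⟨r, hr⟩, List.ofFn_injective h3⟩
  · rintro ⟨h1, h2, h3⟩
    rw [h3, funext fun r : Fin (C.policy i) => h1 r r.2,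
      funext fun r : Fin (leftover k C.policy i) => h2 r r.2]

/-- This keeps the blocks of `W` and the column ranges of `A` disjoint within any `τ` consecutive
slots. -/
theorem eq_of_mod_eq_of_lt {τ n n' : ℕ} (h : n % τ = n' % τ) (h1 : n < n' + τ) (h2 : n' < n + τ) :
    n = n' := by
  rcases Nat.le_total n n' with hle | hle
  · have := (Nat.modEq_iff_dvd' hle).1 h
    have := Nat.eq_zero_of_dvd_of_lt this (by omega)
    omega
  · have := (Nat.modEq_iff_dvd' hle).1 h.symm
    have := Nat.eq_zero_of_dvd_of_lt this (by omega)
    omega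

theorem two_mul_mod_add_lt {m τ s : ℕ} (hτ : 0 < τ) (hs : s < 2 * m) (n : ℕ) :
    2 * m * (n % τ) + s < 2 * m * τ := by
  have h1 : n % τ + 1 ≤ τ := Nat.mod_lt _ hτ
  calc 2 * m * (n % τ) + s < 2 * m * (n % τ) + 2 * m := by omega
    _ = 2 * m * (n % τ + 1) := by ring
    _ ≤ _ := Nat.mul_le_mul_left _ h1

/-- The positions that the first `v` entries of slot `n` occupy in vectors of length `2mτ`. -/
def slotPositions (m τ n v : ℕ) : Finset (Fin (2 * m * τ)) :=
  Finset.univ.filter fun q => (q : ℕ) / (2 * m) = n % τ ∧ (q : ℕ) % (2 * m) < v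

theorem mem_slotPositions {m τ n v : ℕ} {q : Fin (2 * m * τ)} :
    q ∈ slotPositions m τ n v ↔ (q : ℕ) / (2 * m) = n % τ ∧ (q : ℕ) % (2 * m) < v := by
  simp [slotPositions]

theorem card_slotPositions {m τ n v : ℕ} (hτ : 0 < τ) (hv : v ≤ 2 * m) :
    (slotPositions m τ n v).card = v := by
  refine (Finset.card_nbij (t := Finset.range v) (fun q : Fin (2 * m * τ) => (q : ℕ) % (2 * m)) ?_ ?_ ?_).trans
    (Finset.card_range v)
  · intro q hq
    exact Finset.mem_coe.2 (Finset.mem_range.2 (mem_slotPositions.1 hq).2)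
  · intro q hq q' hq' h
    have h1 := (mem_slotPositions.1 hq).1
    have h2 := (mem_slotPositions.1 hq').1
    refine Fin.ext ?_
    rw [← Nat.div_add_mod (q : ℕ) (2 * m), ← Nat.div_add_mod (q' : ℕ) (2 * m), h1, h2]
    simp only at h
    rw [h]
  · intro s hs
    have hs : s < v := Finset.mem_range.1 hs
    refine ⟨⟨2 * m * (n % τ) + s, two_mul_mod_add_lt hτ (by omega) n⟩, mem_slotPositions.2 ?_, ?_⟩
    · have h1 : s < 2 * m := by omega
      rw [Nat.mul_add_div (by omega), Nat.mul_add_mod, Nat.div_eq_of_lt h1, Nat.mod_eq_of_lt h1]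
      exact ⟨rfl, hs⟩
    · simp only [Nat.mul_add_mod]
      exact Nat.mod_eq_of_lt (by omega)

/-! ### Decoding the Spread Code after losses -/

section Decoding

variable {F : Type*} [Field F] {k : ℕ → ℕ} {τ b t m : ℕ} {f : ℕ → ℕ}
  {A : Matrix (Fin (2 * m * τ)) (Fin (2 * m * τ)) F}

theorem vSym_sub (S S' : Messages F k) (j r : ℕ) :
    vSym τ b t f (S - S') j r = vSym τ b t f S j r - vSym τ b t f S' j r := by
  unfold vSym
  split_ifs <;> exact Messages.sym_sub _ _ _ _

theorem wVec_sub (S S' : Messages F k) (i : ℕ) :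
    wVec τ b t m f (S - S') i = wVec τ b t m f S i - wVec τ b t m f S' i := by
  funext q
  simp only [wVec, Pi.sub_apply, ← Finset.sum_sub_distrib]
  refine Finset.sum_congr rfl fun j _ => ?_
  split_ifs
  · exact vSym_sub _ _ _ _
  · simp

/-- By linearity, decodability reduces to showing that a message with zero received packets is zero.
-/
theorem spreadCode_parity_sub (S S' : Messages F k) (i : ℕ) :
    (spreadCode τ b t m k f A).parity i (S - S') =
      (spreadCode τ b t m k f A).parity i S - (spreadCode τ b t m k f A).parity i S' := by
  funext r
  rw [Pi.sub_apply]
  simp only [spreadCode, Messages.sym_sub, wVec_sub, Matrix.sub_vecMul]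
  split_ifs
  · rw [Pi.sub_apply]; ring
  · ring

theorem wVec_eq_zero {S : Messages F k} {n : ℕ}
    (h : ∀ r, n - τ ≤ r → r < n → ∀ s < vLen τ b t k f r, vSym τ b t f S r s = 0) :
    wVec τ b t m f S n = 0 := by
  funext q
  refine Finset.sum_eq_zero fun r hr => ?_
  rw [Finset.mem_Ico] at hr
  split_ifs with hq
  · exact h r hr.1 hr.2 _ hq.2
  · rfl

/-- Once the vectors `V[n-τ], …, V[n-1]` are known, the parity symbols of `X[n]` yield `U[n-τ]`. -/
theorem sym_eq_zero_of_parity {S : Messages F k} {n : ℕ}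
    (hV : ∀ r, n - τ ≤ r → r < n → ∀ s < vLen τ b t k f r, vSym τ b t f S r s = 0)
    (hP : (spreadCode τ b t m k f A).parity n S = 0) {s : ℕ} (hs : s < spreadPar τ b t k f n) :
    S.sym (n - τ) s = 0 := by
  have h := congrFun hP ⟨s, hs⟩
  simpa [spreadCode, wVec_eq_zero hV] using h

/-- The leftover symbols of `S[i]` are among those of `V[i + 1]`. -/
theorem sym_eq_zero_of_vSym_succ {S : Messages F k} {i : ℕ}
    (hV : ∀ s < vLen τ b t k f (i + 1), vSym τ b t f S (i + 1) s = 0) {r : ℕ}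
    (hr : spreadPolicy τ b t k f i ≤ r) : S.sym i r = 0 := by
  rcases Nat.lt_or_ge r (k i) with hk | hk
  · have h := hV ((spreadPolicy τ b t k f (i + 1) - spreadPar τ b t k f (i + 1 + τ)) +
      (r - spreadPolicy τ b t k f i)) (by rw [vLen, leftover]; omega)
    rw [vSym, if_neg (by omega), Nat.add_sub_cancel_left, Nat.add_sub_cancel,
      Nat.add_sub_cancel' hr] at h
    exact h
  · exact S.sym_of_le hk

theorem sym_eq_zero_of_vSym {S : Messages F k} {i : ℕ}
    (hV : ∀ s < vLen τ b t k f i, vSym τ b t f S i s = 0) {r : ℕ}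
    (hr : spreadPar τ b t k f (i + τ) ≤ r) (hr' : r < spreadPolicy τ b t k f i) :
    S.sym i r = 0 := by
  have h := hV (r - spreadPar τ b t k f (i + τ)) (by rw [vLen]; omega)
  rwa [vSym, if_pos (by omega), Nat.add_sub_cancel' hr] at h

theorem vSym_eq_zero_of_packet {S : Messages F k} {i : ℕ}
    (h1 : ∀ r < spreadPolicy τ b t k f i, S.sym i r = 0)
    (h2 : ∀ r < leftover k (spreadPolicy τ b t k f) i,
      S.sym (i - 1) (spreadPolicy τ b t k f (i - 1) + r) = 0)
    (s : ℕ) (hs : s < vLen τ b t k f i) : vSym τ b t f S i s = 0 := by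
  rw [vLen] at hs
  rw [vSym]
  split_ifs with h
  · exact h1 _ (by omega)
  · exact h2 _ (by omega)

/-- After a burst in the slots `j, …, j + b - 1`, the parity symbols of the slots
`j + b, …, j + τ - 1` yield the lost vectors `V`. -/
theorem vSym_eq_zero_of_burst (hA : A.IsCauchy) (hb : 0 < b) (hτ : b < τ) (hkm : ∀ i, k i ≤ m)
    (hk_start : ∀ i < 2 * τ, k i = 0) (hk_end : ∀ i, t < i + 2 * τ → k i = 0)
    (hf : ∀ i ≤ t, f i ≤ k i) {j : ℕ} (hj : 2 * τ ≤ j) (hjt : j + 2 * τ ≤ t + 1)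
    {S : Messages F k}
    (hV : ∀ r, r < j ∨ (j + b ≤ r ∧ r < j + τ) →
      ∀ s < vLen τ b t k f r, vSym τ b t f S r s = 0)
    (hU : ∀ r < j, ∀ s < spreadPar τ b t k f (r + τ), S.sym r s = 0)
    (hP : ∀ n, j + b ≤ n → n < j + τ → (spreadCode τ b t m k f A).parity n S = 0)
    {r : ℕ} (hr : j ≤ r) (hr' : r < j + b) {s : ℕ} (hs : s < vLen τ b t k f r) :
    vSym τ b t f S r s = 0 := by
  classical
  have hvLen : ∀ r, j ≤ r → r < j + b → vLen τ b t k f r ≤ 2 * m := by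
    intro r hr hr'
    have h1 := spreadPolicy_le hb hτ hk_start hf (by omega : r ≤ t)
    have h2 := hkm r
    have h3 := hkm (r - 1)
    obtain ⟨r, rfl⟩ : ∃ r', r = r' + 1 := ⟨r - 1, by omega⟩
    rw [vLen, leftover]
    rw [Nat.add_sub_cancel] at h3
    omega
  have hpar : ∀ n, j + b ≤ n → n < j + τ → spreadPar τ b t k f n ≤ 2 * m := by
    intro n hn hn'
    have h1 := spreadPar_add_le hb hτ hk_start hf (n - τ)
    rw [Nat.sub_add_cancel (by omega)] at h1
    have h2 := hkm (n - τ)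
    omega
  set w : Fin (2 * m * τ) → F := fun q => ∑ r ∈ Finset.Ico j (j + b),
    if (q : ℕ) / (2 * m) = r % τ ∧ (q : ℕ) % (2 * m) < vLen τ b t k f r then
      vSym τ b t f S r ((q : ℕ) % (2 * m)) else 0 with hw
  -- Each window `n - τ, …, n - 1` contains the whole burst, and the other `V` in it vanish. So all
  -- these parities involve one common unknown vector.
  have hwn : ∀ n, j + b ≤ n → n < j + τ → wVec τ b t m f S n = w := by
    intro n hn hn'
    funext q
    refine (Finset.sum_subset (Finset.Ico_subset_Ico (by omega) hn) fun r hr hr' => ?_).symm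
    rw [Finset.mem_Ico] at hr hr'
    split_ifs with hq
    · exact hV r (by omega) _ hq.2
    · rfl
  -- The `U[n-τ]` belong to slots before the burst and vanish, so the parities are plain entries of
  -- `w A`: at least as many as the unknowns.
  have hw0 : w = 0 := by
    refine hA.eq_zero_of_vecMul_eq_zero
      (R := (Finset.Ico j (j + b)).biUnion fun r => slotPositions m τ r (vLen τ b t k f r))
      (C := (Finset.Ico (j + b) (j + τ)).biUnion fun n =>
        slotPositions m τ n (spreadPar τ b t k f n)) ?_ ?_ ?_
    · refine Finset.card_biUnion_le.trans ?_
      rw [Finset.card_biUnion]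
      · rw [Finset.sum_congr rfl fun n hn => card_slotPositions (by omega)
          (hpar n (Finset.mem_Ico.1 hn).1 (Finset.mem_Ico.1 hn).2),
          Finset.sum_congr rfl fun n hn => card_slotPositions (by omega)
          (hvLen n (Finset.mem_Ico.1 hn).1 (Finset.mem_Ico.1 hn).2)]
        exact sum_vLen_le_sum_spreadPar hb hτ hk_start hk_end hf hj hjt
      · intro n hn n' hn' hne
        rw [Finset.mem_coe, Finset.mem_Ico] at hn hn'
        refine Finset.disjoint_left.2 fun q hq hq' => hne ?_
        exact eq_of_mod_eq_of_lt ((mem_slotPositions.1 hq).1.symm.trans (mem_slotPositions.1 hq').1)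
          (by omega) (by omega)
    · intro q hq
      refine Finset.sum_eq_zero fun r hr => if_neg fun h => hq ?_
      exact Finset.mem_biUnion.2 ⟨r, hr, mem_slotPositions.2 h⟩
    · intro q hq
      obtain ⟨n, hn, hq⟩ := Finset.mem_biUnion.1 hq
      rw [Finset.mem_Ico] at hn
      rw [mem_slotPositions] at hq
      have h := congrFun (hP n hn.1 hn.2) ⟨(q : ℕ) % (2 * m), hq.2⟩
      have hqe : 2 * m * (n % τ) + (q : ℕ) % (2 * m) = q := by
        rw [← hq.1]
        exact Nat.div_add_mod _ _
      have hU' := hU (n - τ) (by omega) ((q : ℕ) % (2 * m))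
        (by rw [Nat.sub_add_cancel (by omega)]; exact hq.2)
      simp only [spreadCode, hwn n hn.1 hn.2, hU', hqe, Fin.is_lt, dif_pos, zero_add,
        Fin.eta, Pi.zero_apply] at h
      exact h
  have hm := hvLen r hr hr'
  have h := congrFun hw0 ⟨2 * m * (r % τ) + s, two_mul_mod_add_lt (by omega) (by omega) r⟩
  have hd : (2 * m * (r % τ) + s) / (2 * m) = r % τ := by
    rw [Nat.mul_add_div (by omega), Nat.div_eq_of_lt (by omega), add_zero]
  have hmd : (2 * m * (r % τ) + s) % (2 * m) = s := by
    rw [Nat.mul_add_mod, Nat.mod_eq_of_lt (by omega)]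
  simp only [hw, hd, hmd, Pi.zero_apply] at h
  rw [Finset.sum_eq_single r] at h
  · rwa [if_pos ⟨rfl, hs⟩] at h
  · intro r' hr1 hne
    rw [Finset.mem_Ico] at hr1
    exact if_neg fun h => hne (eq_of_mod_eq_of_lt h.1.symm (by omega) (by omega))
  · exact fun h => absurd (Finset.mem_Ico.2 ⟨hr, hr'⟩) h

/-- A message whose packets are zero outside of an admissible loss is zero. -/
theorem sym_eq_zero_of_received (hA : A.IsCauchy) (hb : 0 < b) (hτ : b < τ) (hkm : ∀ i, k i ≤ m)
    (hk_start : ∀ i < 2 * τ, k i = 0) (hk_end : ∀ i, t < i + 2 * τ → k i = 0)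
    (hf : ∀ i ≤ t, f i ≤ k i) {L : Finset ℕ} (hL : AdmissibleLoss τ b t L) {S : Messages F k}
    (i : ℕ) (hS : ∀ n ≤ i + τ, n ≤ t → n ∉ L →
      (∀ r < spreadPolicy τ b t k f n, S.sym n r = 0) ∧
      (∀ r < leftover k (spreadPolicy τ b t k f) n,
        S.sym (n - 1) (spreadPolicy τ b t k f (n - 1) + r) = 0) ∧
      (spreadCode τ b t m k f A).parity n S = 0) (r : ℕ) : S.sym i r = 0 := by
  induction i using Nat.strong_induction_on generalizing r with
  | _ i ih =>
    have ih : ∀ j < i, ∀ r, S.sym j r = 0 := fun j hj =>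
      ih j hj fun n hn hnt hnL => hS n (by omega) hnt hnL
    by_cases hi : 2 * τ ≤ i ∧ i + 2 * τ ≤ t
    swap
    · refine S.sym_of_le ?_
      rcases Nat.lt_or_ge i (2 * τ) with h | h
      · rw [hk_start i h]; exact Nat.zero_le _
      · rw [hk_end i (by omega)]; exact Nat.zero_le _
    obtain ⟨hi, hit⟩ := hi
    have hVlt : ∀ j < i, ∀ s < vLen τ b t k f j, vSym τ b t f S j s = 0 := by
      intro j hj s _
      rw [vSym]
      split_ifs
      · exact ih j hj _
      · exact ih (j - 1) (by omega) _
    have hVrec : ∀ n ≤ i + τ, n ∉ L → ∀ s < vLen τ b t k f n, vSym τ b t f S n s = 0 := by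
      intro n hn hnL
      obtain ⟨h1, h2, -⟩ := hS n hn (by omega) hnL
      exact vSym_eq_zero_of_packet h1 h2
    by_cases hiL : i ∈ L
    · have hrec : ∀ n, i + b ≤ n → n < i + b + τ → n ∉ L := hL i hiL (by omega)
      have hV : ∀ n < i + τ, ∀ s < vLen τ b t k f n, vSym τ b t f S n s = 0 := by
        intro n hn s hs
        rcases Nat.lt_or_ge n i with h | h
        · exact hVlt n h s hs
        rcases Nat.lt_or_ge n (i + b) with h' | h'
        · refine vSym_eq_zero_of_burst hA hb hτ hkm hk_start hk_end hf hi (by omega) ?_ ?_ ?_ h h' hs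
          · rintro r (hr | hr)
            · exact hVlt r hr
            · exact hVrec r (by omega) (hrec r (by omega) (by omega))
          · exact fun r hr s _ => ih r hr s
          · exact fun n hn hn' => (hS n (by omega) (by omega) (hrec n (by omega) (by omega))).2.2
        · exact hVrec n (by omega) (hrec n (by omega) (by omega)) s hs
      -- `S[i]` splits into `U[i]`, obtained from `P[i+τ]`, a middle part in `V[i]`, and the
      -- leftover in `V[i+1]`.
      rcases Nat.lt_or_ge r (spreadPar τ b t k f (i + τ)) with hr | hr
      · have := sym_eq_zero_of_parity (n := i + τ) (fun r _ h => hV r h)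
          (hS (i + τ) le_rfl (by omega) (hrec _ (by omega) (by omega))).2.2 hr
        rwa [Nat.add_sub_cancel] at this
      rcases Nat.lt_or_ge r (spreadPolicy τ b t k f i) with hr' | hr'
      · exact sym_eq_zero_of_vSym (hV i (by omega)) hr hr'
      · exact sym_eq_zero_of_vSym_succ (hV (i + 1) (by omega)) hr'
    · obtain ⟨h1, h2, -⟩ := hS i (by omega) (by omega) hiL
      rcases Nat.lt_or_ge r (spreadPolicy τ b t k f i) with hr | hr
      · exact h1 r hr
      refine sym_eq_zero_of_vSym_succ (fun s hs => ?_) hr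
      -- Only the leftover of `S[i]` is missing. If `X[i+1]` is lost, the burst from `i + 1` on is
      -- resolved by the parities up to slot `i + τ`, just in time.
      by_cases hiL' : i + 1 ∈ L
      · have hrec : ∀ n, i + 1 + b ≤ n → n < i + 1 + b + τ → n ∉ L := hL (i + 1) hiL' (by omega)
        refine vSym_eq_zero_of_burst hA hb hτ hkm hk_start hk_end hf (j := i + 1) (by omega)
          (by omega) ?_ ?_ ?_ le_rfl (by omega) hs
        · rintro r (hr | hr)
          · rcases (by omega : r < i ∨ r = i) with hr | rfl
            · exact hVlt r hr
            · exact hVrec r (by omega) hiL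
          · exact hVrec r (by omega) (hrec r (by omega) (by omega))
        · intro r hr s' hs'
          rcases (by omega : r < i ∨ r = i) with hr | rfl
          · exact ih r hr s'
          · exact h1 s' (lt_of_lt_of_le hs' (spreadPar_le_spreadPolicy r))
        · exact fun n hn hn' => (hS n (by omega) (by omega) (hrec n (by omega) (by omega))).2.2
      · exact hVrec (i + 1) (by omega) hiL' s hs

end Decoding

/-- A decoder exists as soon as what is received determines the message. -/
theorem exists_decoder {ι α β γ : Type*} [Nonempty γ] (r : ι → α → β) (g : α → γ)
    (h : ∀ x y a a', r x a = r y a' → g a = g a') : ∃ dec : β → γ, ∀ x a, dec (r x a) = g a := by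
  classical
  refine ⟨fun z => if hz : ∃ x a, r x a = z then g hz.choose_spec.choose else Classical.arbitrary γ,
    fun x a => ?_⟩
  have hz : ∃ x' a', r x' a' = r x a := ⟨x, a, rfl⟩
  simp only [dif_pos hz]
  exact h _ _ _ _ hz.choose_spec.choose_spec

/-! ### Received packets and rates -/

namespace StreamingCode

/-- Two different loss sets are allowed because the decoder is not told which one occurred; losses
show up as `none`. -/
theorem packet_eq_of_received_eq {F : Type*} [Zero F] {k : ℕ → ℕ} {C : StreamingCode F k} {t T : ℕ}
    {L L' : Finset ℕ} {S S' : Messages F k} (h : C.received t L T S = C.received t L' T S') {n : ℕ}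
    (hT : n ≤ T) (ht : n ≤ t) (hL : n ∉ L) : C.packet n S = C.packet n S' := by
  have h := congrFun h n
  simp only [received, if_pos (show n ≤ T ∧ n ≤ t ∧ n ∉ L from ⟨hT, ht, hL⟩)] at h
  split_ifs at h
  exact Option.some.inj h

/-- The parity symbols are what a streaming code sends in addition to the messages. -/
theorem sum_size {F : Type*} {k : ℕ → ℕ} (C : StreamingCode F k) {t : ℕ}
    (hC : ∀ i ≤ t, C.policy i ≤ k i) (hkt : k t = 0) :
    ∑ i ∈ Finset.range (t + 1), C.size i =
      ∑ i ∈ Finset.range (t + 1), k i + ∑ i ∈ Finset.range (t + 1), C.par i := by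
  -- The extra summand is what is still to be sent of `S[n]`; it vanishes at `n = t`.
  have key : ∀ n ≤ t, ∑ i ∈ Finset.range (n + 1), C.size i + (k n - C.policy n) =
      ∑ i ∈ Finset.range (n + 1), k i + ∑ i ∈ Finset.range (n + 1), C.par i := by
    intro n
    induction n with
    | zero =>
      intro h
      have := hC 0 h
      simp only [zero_add, Finset.sum_range_one, size, leftover]
      omega
    | succ n ih =>
      intro h
      have h1 := ih (by omega)
      have h2 := hC (n + 1) h
      rw [Finset.sum_range_succ, Finset.sum_range_succ k, Finset.sum_range_succ C.par, size, leftover]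
      omega
  have := key t le_rfl
  omega

theorem rate_le_rate {F : Type*} {k : ℕ → ℕ} {C D : StreamingCode F k} {t : ℕ}
    (hC : ∀ i ≤ t, C.policy i ≤ k i) (hD : ∀ i ≤ t, D.policy i ≤ k i) (hkt : k t = 0)
    (h : ∑ i ∈ Finset.range (t + 1), D.par i ≤ ∑ i ∈ Finset.range (t + 1), C.par i) :
    C.rate t ≤ D.rate t := by
  unfold rate
  rw [← Nat.cast_sum, ← Nat.cast_sum, ← Nat.cast_sum, C.sum_size hC hkt, D.sum_size hD hkt]
  rcases Nat.eq_zero_or_pos (∑ i ∈ Finset.range (t + 1), k i) with h0 | hpos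
  · simp [h0]
  · refine div_le_div_of_nonneg_left (Nat.cast_nonneg _) ?_ ?_
    · exact_mod_cast Nat.add_pos_left hpos _
    · exact_mod_cast Nat.add_le_add_left h _

end StreamingCode

/-! ### Converse: counting messages after a burst -/

/-- The messages whose symbols are prescribed on `Φ` and zero elsewhere. -/
def messagesOn {F : Type*} [Zero F] (k : ℕ → ℕ) (Φ : Finset (Σ _ : ℕ, ℕ)) (φ : Φ → F) :
    Messages F k :=
  fun i r => if h : ⟨i, (r : ℕ)⟩ ∈ Φ then φ ⟨⟨i, r⟩, h⟩ else 0

theorem sym_messagesOn_of_notMem {F : Type*} [Zero F] {k : ℕ → ℕ} {Φ : Finset (Σ _ : ℕ, ℕ)}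
    (φ : Φ → F) {i r : ℕ} (h : ⟨i, r⟩ ∉ Φ) : (messagesOn k Φ φ).sym i r = 0 := by
  unfold Messages.sym messagesOn
  split_ifs <;> rfl

theorem messagesOn_eq_of_notMem {F : Type*} [Zero F] {k : ℕ → ℕ} {Φ : Finset (Σ _ : ℕ, ℕ)}
    (φ φ' : Φ → F) {i : ℕ} (h : ∀ r, ⟨i, r⟩ ∉ Φ) :
    messagesOn k Φ φ i = messagesOn k Φ φ' i :=
  Messages.eq_of_sym_eq fun r _ => by
    rw [sym_messagesOn_of_notMem φ (h r), sym_messagesOn_of_notMem φ' (h r)]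

theorem card_le_sum_of_injective {F : Type*} [Fintype F] [Nontrivial F] {ι : Type*} [Fintype ι]
    {s : Finset ℕ} {p : ℕ → ℕ} {g : (ι → F) → (n : s) → Fin (p n) → F} (hg : Function.Injective g) :
    Fintype.card ι ≤ ∑ n ∈ s, p n := by
  classical
  have h := Fintype.card_le_of_injective g hg
  simp only [Fintype.card_pi, Fintype.card_fin, Finset.prod_const, Finset.card_univ,
    Finset.prod_pow_eq_pow_sum] at h
  rw [Finset.sum_coe_sort s p] at h
  exact (Nat.pow_le_pow_iff_right Fintype.one_lt_card).1 h

theorem admissibleLoss_Ico (τ b t j : ℕ) : AdmissibleLoss τ b t (Finset.Ico j (j + b)) := by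
  intro i hi _ n hn _ hn'
  rw [Finset.mem_Ico] at hi hn'
  omega

/-- The sizes of a streaming code satisfy the constraints of the integer program: after a burst, the
parity symbols have to carry the lost symbols. -/
theorem StreamingCode.IsValid.burst_le {F : Type*} [Field F] [Finite F] {k : ℕ → ℕ} {τ b t : ℕ}
    (hb : 0 < b) (hτ : b < τ) {C : StreamingCode F k} (hC : C.IsValid τ b t) {i j : ℕ}
    (hi : 3 * τ ≤ i) (hit : i + τ ≤ t) (hj : i - τ + 1 ≤ j + b) (hji : j ≤ i - τ + 1) :
    -(C.policy (j - 1) : ℤ)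
      - (if j + b - 1 = i - τ then (k (i - τ) : ℤ) - C.policy (i - τ) else 0)
      + ∑ r ∈ Finset.Icc (j - 1) (i - τ), (k r : ℤ) ≤
    ∑ r ∈ Finset.Icc (j + b) i, (C.par r : ℤ) := by
  classical
  have := Fintype.ofFinite F
  obtain ⟨e, rfl⟩ : ∃ e, i = e + τ := ⟨i - τ, by omega⟩
  rw [Nat.add_sub_cancel] at *
  -- `Φ` collects the symbols of `S[j-1], …, S[e]` sent in the clear only during the burst: the
  -- start of `S[j-1]` precedes it, and if it ends in slot `e`, the leftover of `S[e]` follows it.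
  set lo : ℕ → ℕ := fun r => if r = j - 1 then C.policy (j - 1) else 0 with hlo
  set hi' : ℕ → ℕ := fun r => if r = e ∧ j + b - 1 = e then min (k e) (C.policy e) else k r with hhi
  set Φ : Finset (Σ _ : ℕ, ℕ) := (Finset.Icc (j - 1) e).sigma fun r => Finset.Ico (lo r) (hi' r)
    with hΦ
  have hmem : ∀ r s, (⟨r, s⟩ : Σ _ : ℕ, ℕ) ∈ Φ ↔ (j - 1 ≤ r ∧ r ≤ e) ∧ lo r ≤ s ∧ s < hi' r := by
    intro r s
    rw [hΦ, Finset.mem_sigma, Finset.mem_Icc, Finset.mem_Ico]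
  have hcard : Fintype.card Φ ≤ ∑ n ∈ Finset.Icc (j + b) (e + τ), C.par n := by
    refine card_le_sum_of_injective (F := F)
      (g := fun φ n => C.parity n (messagesOn k Φ φ)) fun φ φ' h => ?_
    have hpar : ∀ n, j + b ≤ n → n ≤ e + τ →
        C.parity n (messagesOn k Φ φ) = C.parity n (messagesOn k Φ φ') :=
      fun n h1 h2 => congrFun h ⟨n, Finset.mem_Icc.2 ⟨h1, h2⟩⟩
    have hsym : ∀ r s, ⟨r, s⟩ ∉ Φ →
        (messagesOn k Φ φ).sym r s = (messagesOn k Φ φ').sym r s := fun r s h => by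
      rw [sym_messagesOn_of_notMem φ h, sym_messagesOn_of_notMem φ' h]
    have hpacket : ∀ n ≤ e + τ, n ∉ Finset.Ico j (j + b) →
        C.packet n (messagesOn k Φ φ) = C.packet n (messagesOn k Φ φ') := by
      intro n hn hnL
      rw [Finset.mem_Ico] at hnL
      have h1 : ∀ r < C.policy n, (messagesOn k Φ φ).sym n r = (messagesOn k Φ φ').sym n r := by
        intro r hr
        refine hsym n r fun hm => ?_
        rw [hmem] at hm
        obtain rfl : n = j - 1 := by omega
        simp only [hlo, if_true] at hm
        omega
      rw [C.packet_eq_iff]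
      refine ⟨h1, fun r hr => hsym _ _ fun hm => ?_, ?_⟩
      · rw [hmem] at hm
        rcases n with _ | n
        · simp [leftover] at hr
        · rw [Nat.add_sub_cancel] at hm
          obtain rfl : n = e := by omega
          simp only [hhi] at hm
          rw [if_pos ⟨trivial, by omega⟩] at hm
          omega
      -- Parities before the burst cannot see `Φ`, by causality.
      · rcases Nat.lt_or_ge n j with hlt | hge
        · refine hC.causal n (by omega) _ _ (fun r hr => messagesOn_eq_of_notMem _ _ fun s hm => ?_) h1
          rw [hmem] at hm
          omega
        · exact hpar n (by omega) hn
    funext ⟨⟨r, s⟩, hm⟩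
    have hm' := (hmem r s).1 hm
    obtain ⟨dec, hdec⟩ := hC.worstCase r (by omega)
    have hd := hdec _ (admissibleLoss_Ico τ b t j)
    have hrec : C.received t (Finset.Ico j (j + b)) (r + τ) (messagesOn k Φ φ) =
        C.received t (Finset.Ico j (j + b)) (r + τ) (messagesOn k Φ φ') := by
      funext n
      unfold StreamingCode.received
      split_ifs with hn
      · rw [hpacket n (by omega) hn.2.2]
      · rfl
    have heq : messagesOn k Φ φ r = messagesOn k Φ φ' r := (hd _).symm.trans ((congrArg dec hrec).trans (hd _))
    have hsk : s < k r := by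
      have := hm'.2.2
      simp only [hhi] at this
      split_ifs at this with hc
      · rw [hc.1]; omega
      · exact this
    have := congrFun heq ⟨s, hsk⟩
    simpa only [messagesOn, dif_pos hm] using this
  have hsum : Fintype.card Φ = ∑ r ∈ Finset.Icc (j - 1) e, (hi' r - lo r) := by
    rw [Fintype.card_coe, hΦ, Finset.card_sigma]
    simp
  rw [hsum] at hcard
  have hcard' : (∑ r ∈ Finset.Icc (j - 1) e, ((hi' r - lo r : ℕ) : ℤ)) ≤
      ∑ n ∈ Finset.Icc (j + b) (e + τ), (C.par n : ℤ) := by exact_mod_cast hcard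
  refine le_trans ?_ hcard'
  -- The cardinality uses truncated subtraction, so only this inequality is needed.
  have hpt : ∑ r ∈ Finset.Icc (j - 1) e, ((k r : ℤ) - (if r = j - 1 then (C.policy (j - 1) : ℤ) else 0)
      - (if r = e then (if j + b - 1 = e then (k e : ℤ) - C.policy e else 0) else 0)) ≤
      ∑ r ∈ Finset.Icc (j - 1) e, ((hi' r - lo r : ℕ) : ℤ) := by
    refine Finset.sum_le_sum fun r _ => ?_
    have := hC.policy_le e (by omega)
    simp only [hhi, hlo]
    by_cases h1 : r = e
    · subst h1
      split_ifs <;> omega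
    · split_ifs <;> omega
  refine le_trans (le_of_eq ?_) hpt
  rw [Finset.sum_sub_distrib, Finset.sum_sub_distrib, Finset.sum_ite_eq', Finset.sum_ite_eq',
    if_pos (Finset.mem_Icc.2 ⟨le_rfl, by omega⟩), if_pos (Finset.mem_Icc.2 ⟨by omega, le_rfl⟩)]
  ring

theorem StreamingCode.IsValid.ipFeasible {F : Type*} [Field F] [Finite F] {k : ℕ → ℕ} {τ b t : ℕ}
    (hb : 0 < b) (hτ : b < τ) {C : StreamingCode F k} (hC : C.IsValid τ b t) {l : ℕ} {f₀ p₀ : ℕ → ℕ}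
    (hl : C.Extends l f₀ p₀) : IPFeasible τ b t k l f₀ p₀ C.policy C.par where
  policy_le := hC.policy_le
  burst _ hi hit _ hj hji := hC.burst_le hb hτ hi hit hj hji
  prior := hl

/-! ### Validity of the Spread Code and the main theorem -/

section SpreadCode

variable {F : Type*} [Field F] {τ b t m : ℕ} {k f : ℕ → ℕ}
  {A : Matrix (Fin (2 * m * τ)) (Fin (2 * m * τ)) F}

theorem spreadCode_isValid (hb : 0 < b) (hτ : b < τ) (hkm : ∀ i, k i ≤ m)
    (hk_start : ∀ i < 2 * τ, k i = 0) (hk_end : ∀ i, t < i + 2 * τ → k i = 0) (hA : A.IsCauchy)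
    (hf : ∀ i ≤ t, f i ≤ k i) : (spreadCode τ b t m k f A).IsValid τ b t where
  policy_le i hi := spreadPolicy_le hb hτ hk_start hf hi
  empty i hi := spreadPar_eq_zero (by omega) (.inl (by omega))
  causal i _ S S' h _ := by
    funext ⟨r, hr⟩
    -- The index `r` witnesses a parity symbol in slot `i`. Thus `i` is positive and `i - τ` is a
    -- strictly earlier slot.
    have hi : 3 * τ ≤ i := by
      by_contra hi
      have : r < spreadPar τ b t k f i := hr
      rw [spreadPar_eq_zero (by omega) (.inl (by omega))] at this
      omega
    have hs : ∀ j < i, ∀ s, S.sym j s = S'.sym j s := fun j hj s => by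
      unfold Messages.sym
      rw [h j hj]
    have hW : wVec τ b t m f S i = wVec τ b t m f S' i := by
      funext q
      refine Finset.sum_congr rfl fun j hj => ?_
      rw [Finset.mem_Ico] at hj
      unfold vSym
      rw [hs j (by omega), hs (j - 1) (by omega)]
    simp only [spreadCode, hW, hs (i - τ) (by omega)]
  lossless i hi := by
    obtain ⟨dec, hdec⟩ := exists_decoder
      (fun (_ : Unit) S => (spreadCode τ b t m k f A).received t ∅ (i + 1) S)
      (fun S : Messages F k => S i) fun _ _ S S' h => by
        refine Messages.eq_of_sym_eq fun r hr => ?_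
        have hit : i + 1 ≤ t := by
          by_contra hit
          rw [hk_end i (by omega)] at hr
          omega
        have h1 := StreamingCode.packet_eq_of_received_eq h (by omega : i ≤ i + 1) hi (by simp)
        have h2 := StreamingCode.packet_eq_of_received_eq h le_rfl hit (by simp)
        rw [StreamingCode.packet_eq_iff] at h1 h2
        rcases Nat.lt_or_ge r (spreadPolicy τ b t k f i) with hr' | hr'
        · exact h1.1 r hr'
        · have := h2.2.1 (r - spreadPolicy τ b t k f i) (Nat.sub_lt_sub_right hr' hr)
          simp only [Nat.add_sub_cancel] at this
          change S.sym i (spreadPolicy τ b t k f i + _) = S'.sym i (spreadPolicy τ b t k f i + _)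
            at this
          rwa [Nat.add_sub_cancel' hr'] at this
    exact ⟨dec, fun S => hdec () S⟩
  worstCase i hi := by
    obtain ⟨dec, hdec⟩ := exists_decoder
      (fun (L : {L : Finset ℕ // AdmissibleLoss τ b t L}) S =>
        (spreadCode τ b t m k f A).received t L.1 (i + τ) S)
      (fun S : Messages F k => S i) fun L _ S S' h => by
        refine Messages.eq_of_sym_eq fun r _ => ?_
        rw [← sub_eq_zero, ← Messages.sym_sub]
        refine sym_eq_zero_of_received hA hb hτ hkm hk_start hk_end hf L.2 i (fun n hn hnt hnL => ?_) r
        have h1 := StreamingCode.packet_eq_of_received_eq h hn hnt hnL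
        rw [StreamingCode.packet_eq_iff] at h1
        simp only [Messages.sym_sub, sub_eq_zero, spreadCode_parity_sub]
        exact h1
    exact ⟨dec, fun L hL S => hdec ⟨L, hL⟩ S⟩

theorem List.ofFn_eq_ofFn {α : Type*} {n n' : ℕ} (h : n = n') {u : Fin n → α} {v : Fin n' → α}
    (huv : ∀ r (h1 : r < n) (h2 : r < n'), u ⟨r, h1⟩ = v ⟨r, h2⟩) : List.ofFn u = List.ofFn v := by
  subst h
  exact congrArg _ (funext fun r => huv r r.2 r.2)

/-- The packets of the Spread Code depend on the earlier policies only. -/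
theorem spreadCode_packet_congr (hb : 0 < b) (hτ : b < τ) {g : ℕ → ℕ} {l : ℕ}
    (h : ∀ j ≤ l, f j = g j) {j : ℕ} (hj : j ≤ l) (S : Messages F k) :
    (spreadCode τ b t m k f A).packet j S = (spreadCode τ b t m k g A).packet j S := by
  have hpol : ∀ r ≤ l, spreadPolicy τ b t k f r = spreadPolicy τ b t k g r :=
    fun r hr => spreadPolicy_congr hb hτ h hr
  have hpar : ∀ r ≤ l + τ, spreadPar τ b t k f r = spreadPar τ b t k g r :=
    fun r hr => spreadPar_congr hb hτ h hr
  have hleft : ∀ r ≤ l, leftover k (spreadPolicy τ b t k f) r =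
      leftover k (spreadPolicy τ b t k g) r := by
    rintro (_ | r) hr
    · rfl
    · rw [leftover, leftover, hpol r (by omega)]
  have hW : wVec τ b t m f S j = wVec τ b t m g S j := by
    funext q
    refine Finset.sum_congr rfl fun r hr => ?_
    rw [Finset.mem_Ico] at hr
    unfold vLen vSym
    rw [hpol r (by omega), hpol (r - 1) (by omega), hpar (r + τ) (by omega), hleft r (by omega)]
  unfold StreamingCode.packet
  simp only [spreadCode]
  congr 1
  · congr 1
    · exact List.ofFn_eq_ofFn (hpol j hj) fun _ _ _ => rfl
    · exact List.ofFn_eq_ofFn (hleft j hj) fun r _ _ => by simp only [hpol (j - 1) (by omega)]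
  · exact List.ofFn_eq_ofFn (hpar j (by omega)) fun r _ _ => by simp only [hW]

end SpreadCode

/-- If the packets `X[0], …, X[l]` were sent with policies `f₀ j` and `p₀ j` parity symbols, and `f` is
output by the integer program with these values fixed, then the Spread Code of `f` is a streaming code
whose rate is at least that of every streaming code with this prior transmission.  If moreover the prior
transmission is the one of a Spread Code (with policies `g`), then the Spread Code of `f` sends
the same packets `X[0], …, X[l]`, so that the best possible rate is attained. -/
theorem mainTheorem7 {F : Type*} [Field F] [Finite F] (τ b t m : ℕ) (hb : 0 < b) (hτ : b < τ)
    (ht : 4 * τ ≤ t) (hm : 0 < m) (k : ℕ → ℕ) (hkm : ∀ i, k i ≤ m)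
    (hk_start : ∀ i < 2 * τ, k i = 0) (hk_end : ∀ i, t < i + 2 * τ → k i = 0)
    (A : Matrix (Fin (2 * m * τ)) (Fin (2 * m * τ)) F) (hA : A.IsCauchy)
    (l : ℕ) (hl : l ≤ t - τ) (f₀ p₀ f : ℕ → ℕ) (hf : IPOutput τ b t k l f₀ p₀ f) :
    (spreadCode τ b t m k f A).IsValid τ b t ∧
    (∀ C : StreamingCode F k, C.IsValid τ b t → C.Extends l f₀ p₀ →
      C.rate t ≤ (spreadCode τ b t m k f A).rate t) ∧
    (∀ g : ℕ → ℕ, (∀ i ≤ t, g i ≤ k i) → (∀ j ≤ l, g j = f₀ j) →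
      (spreadCode τ b t m k g A).Extends l f₀ p₀ →
      (∀ j ≤ l, ∀ S : Messages F k,
        (spreadCode τ b t m k f A).packet j S = (spreadCode τ b t m k g A).packet j S) ∧
      IsGreatest {R : ℝ | ∃ C : StreamingCode F k, C.IsValid τ b t ∧ C.Extends l f₀ p₀ ∧
        R = C.rate t} ((spreadCode τ b t m k f A).rate t)) := by
  obtain ⟨q, hq, hopt⟩ := hf
  have hkt : k t = 0 := hk_end t (by omega)
  have hvalid : (spreadCode τ b t m k f A).IsValid τ b t :=
    spreadCode_isValid hb hτ hkm hk_start hk_end hA hq.policy_le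
  have hrate : ∀ C : StreamingCode F k, C.IsValid τ b t → C.Extends l f₀ p₀ →
      C.rate t ≤ (spreadCode τ b t m k f A).rate t := fun C hC hCl => by
    refine StreamingCode.rate_le_rate hC.policy_le hvalid.policy_le hkt ?_
    -- The Spread Code needs at most the optimal value of the program, and the sizes of `C` are a
    -- feasible point.
    have h1 : ∑ i ∈ Finset.range (t + 1), spreadPar τ b t k f i ≤
        ∑ i ∈ Finset.range (t + 1), q i := by
      exact_mod_cast sum_spreadPar_le hb hτ hq (t + 1)
    exact h1.trans (hopt _ _ (hC.ipFeasible hb hτ hCl))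
  refine ⟨hvalid, hrate, fun g _ hgf hg => ?_⟩
  have hfg : ∀ j ≤ l, f j = g j := fun j hj => (hq.prior j hj).1.trans (hgf j hj).symm
  refine ⟨fun j hj S => spreadCode_packet_congr hb hτ hfg hj S,
    ⟨_, hvalid, fun j hj => ⟨?_, ?_⟩, rfl⟩, ?_⟩
  · exact (spreadPolicy_congr hb hτ hfg hj).trans (hg j hj).1
  · exact (spreadPar_congr hb hτ hfg (by omega)).trans (hg j hj).2
  · rintro _ ⟨C, hC, hCl, rfl⟩
    exact hrate C hC hCl
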